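/- A rational polygon is the convex hull in $\mathbb{R}^2$ of finitely many points of $\mathbb{Q}^2$, not all contained in a line. For a rational polygon $P$, let $I_P$ and $b_P$ be the numbers of points of $\mathbb{Z}^2$ in the interior of $P$ and on the boundary of $P$, respectively, and let $\operatorname{conv}(P\cap\mathbb{Z}^2)$ be the integral hull of $P$. Proposition. Let $P$ be a rational polygon whose integral hull $\operatorname{conv}(P\cap\mathbb{Z}^2)$ contains a point of $\mathbb{Z}^2$ in its interior. Then either $(I_P,b_P)=(1,9)$ or $b_P\le 2I_P+6$. -/

import Mathlib

namespace RationalPolygon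

/-- The integer lattice `ℤ²` inside the plane `ℝ²`. -/
def lattice : Set (Fin 2 → ℝ) := {x | ∀ i, ∃ n : ℤ, x i = (n : ℝ)}

/-- The set `ℚ²` of rational points of the plane `ℝ²`. -/
def rationalPoints : Set (Fin 2 → ℝ) := {x | ∀ i, ∃ q : ℚ, x i = (q : ℝ)}

/-- A rational polygon: the convex hull of finitely many rational points,
not all contained in a line. -/
def IsRationalPolygon (P : Set (Fin 2 → ℝ)) : Prop :=
  ∃ V : Set (Fin 2 → ℝ), V.Finite ∧ V ⊆ rationalPoints ∧ ¬ Collinear ℝ V ∧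
    P = convexHull ℝ V

/-- The integral hull `conv (P ∩ ℤ²)`. -/
def integralHull (P : Set (Fin 2 → ℝ)) : Set (Fin 2 → ℝ) :=
  convexHull ℝ (P ∩ lattice)

/-- The number `I_P` of lattice points in the interior of `P`. -/
noncomputable def interiorCount (P : Set (Fin 2 → ℝ)) : ℕ :=
  (interior P ∩ lattice).ncard

/-- The number `b_P` of lattice points on the boundary of `P`. -/
noncomputable def boundaryCount (P : Set (Fin 2 → ℝ)) : ℕ :=
  (frontier P ∩ lattice).ncard

/-- A bounded set has finitely many lattice points. -/
theorem finite_inter_lattice {S : Set (Fin 2 → ℝ)} (hS : Bornology.IsBounded S) :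
    (S ∩ lattice).Finite := by
  obtain ⟨R, hR⟩ := hS.subset_closedBall 0
  refine ((Set.finite_Icc (fun _ : Fin 2 => -⌈R⌉) (fun _ => ⌈R⌉)).image
    (fun (z : Fin 2 → ℤ) i => (z i : ℝ))).subset ?_
  rintro x ⟨hxS, hx⟩
  choose z hz using hx
  have hx' : ‖x‖ ≤ R := by simpa using hR hxS
  have key : ∀ i, -⌈R⌉ ≤ z i ∧ z i ≤ ⌈R⌉ := by
    intro i
    have h1 : |x i| ≤ R := (norm_le_pi_norm x i).trans hx'
    rw [hz i] at h1
    have h2 : ((|z i| : ℤ) : ℝ) ≤ ((⌈R⌉ : ℤ) : ℝ) := by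
      push_cast
      exact h1.trans (Int.le_ceil R)
    exact abs_le.mp (by exact_mod_cast h2)
  exact ⟨z, ⟨fun i => (key i).1, fun i => (key i).2⟩, funext fun i => (hz i).symm⟩

/-- Both lattice point counts of a rational polygon are cardinalities of finite sets. -/
theorem IsRationalPolygon.finite_counts {P : Set (Fin 2 → ℝ)} (hP : IsRationalPolygon P) :
    (interior P ∩ lattice).Finite ∧ (frontier P ∩ lattice).Finite := by
  obtain ⟨V, hV, -, -, rfl⟩ := hP
  have hb : Bornology.IsBounded (convexHull ℝ V) := isBounded_convexHull.mpr hV.isBounded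
  exact ⟨finite_inter_lattice (hb.subset interior_subset),
    finite_inter_lattice (hb.closure.subset frontier_subset_closure)⟩

end RationalPolygon

/-!
Let `T` be the set of lattice points of the rational polygon `P` and `J` the set of those in its
interior, so that `b_P = #T - #J` and `I_P = #J`. The proof follows Scott's argument for lattice
polygons, with the area (which Pick's formula would give as half of `#T + #J - 2`) replaced by a
direct row-by-row count. It applies to any compact convex set in place of `P`, as long as every
primitive integral linear form takes on `T` values differing by at least two; an interior lattice
point of the integral hull guarantees this (`exists_lt_of_mem_interior_integralHull`).

Choose unimodular coordinates in which the lattice width `p` of `T` is attained by the second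
coordinate. Let `s` be the sum of the lengths of the lattice segments cut out by the lowest and the
highest row of `T`. Three estimates hold.

* Every other row has at most two non-interior lattice points, so `b_P ≤ s + 2 * p`
  (`LatticeData.card_sub_card_le`).
* A chord from `u` to `v` in one of the other rows forces
  `#T_y + #J_y ≥ (⌊v⌋ + ⌈v⌉) - (⌊u⌋ + ⌈u⌉)` for the points in that row. The function
  `t ↦ ⌊t⌋ + ⌈t⌉` is antisymmetric about every point of `(1/2)ℤ`, so its sum over the rows met
  by a lattice segment has a closed form (`sum_twiceRound_lineAt`). Taking the
  chords of the trapezoid spanned by the extreme rows gives `#T + #J - 2 ≥ p * s` (`LatticeData.trapezoid_le`).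
* Adding a leftmost and a rightmost point to the trapezoid, after a shear that brings the extreme
  rows close to lying above each other, gives `2 * (#T + #J - 2) ≥ p * (p + s)` if `s ≤ p`
  (`LatticeData.height_mul_le_of_shears`). Here the minimality of `p` is used: the width in the
  sheared first coordinate is at least `p`.

The second estimate yields `b_P ≤ 2 * I_P + 6` if `p = 2` or `s ≥ 4`, since
`(p - 2) * (s - 4) ≥ 0`, and the third one if `p ≥ 4`, since `(p - 4) * (p - 4 + s) ≥ 0`. For
`p = 3` and `s ≤ 3` integrality leaves only the exception `b_P = 9`, `I_P = 1`
(`LatticeData.scott_of_frame`).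
-/

namespace RationalPolygon

/-! ### Lattice points and unimodular coordinate changes -/

/-- The point of the plane with the given integer coordinates. -/
def pt (z : ℤ × ℤ) : Fin 2 → ℝ := ![(z.1 : ℝ), (z.2 : ℝ)]

theorem pt_injective : Function.Injective pt := by
  intro z w h
  have h0 := congrFun h 0
  have h1 := congrFun h 1
  simp only [pt, Matrix.cons_val_zero, Matrix.cons_val_one, Int.cast_inj] at h0 h1
  exact Prod.ext h0 h1

theorem range_pt : Set.range pt = lattice := by
  ext x
  constructor
  · rintro ⟨z, rfl⟩ i
    fin_cases i
    · exact ⟨z.1, rfl⟩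
    · exact ⟨z.2, rfl⟩
  · intro h
    choose n hn using h
    refine ⟨(n 0, n 1), funext fun i => ?_⟩
    fin_cases i
    · exact (hn 0).symm
    · exact (hn 1).symm

theorem ncard_inter_lattice (S : Set (Fin 2 → ℝ)) :
    (S ∩ lattice).ncard = (pt ⁻¹' S).ncard := by
  rw [← range_pt, ← Set.image_preimage_eq_inter_range, Set.ncard_image_of_injective _ pt_injective]

/-- A convex set `K` with nonempty interior, together with the finite set `T` of its lattice points
and the finite set `J` of the lattice points of its interior. -/
structure LatticeData (K : Set (Fin 2 → ℝ)) (T J : Finset (ℤ × ℤ)) : Prop where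
  convex : Convex ℝ K
  interior_nonempty : (interior K).Nonempty
  mem_T : ∀ z, z ∈ T ↔ pt z ∈ K
  mem_J : ∀ z, z ∈ J ↔ pt z ∈ interior K

/-- The automorphism of `ℤ²` given by an integer matrix of determinant one. -/
def unimodular (a b c d : ℤ) (h : a * d - b * c = 1) : ℤ × ℤ ≃ ℤ × ℤ where
  toFun z := (a * z.1 + b * z.2, c * z.1 + d * z.2)
  invFun z := (d * z.1 - b * z.2, a * z.2 - c * z.1)
  left_inv z := by
    refine Prod.ext ?_ ?_
    · linear_combination z.1 * h
    · linear_combination z.2 * h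
  right_inv z := by
    refine Prod.ext ?_ ?_
    · linear_combination z.1 * h
    · linear_combination z.2 * h

/-- A unimodular change of coordinates carries a convex set to a convex set, and transports
the sets of its lattice points and of its interior lattice points. -/
theorem LatticeData.exists_map {K : Set (Fin 2 → ℝ)} {T J : Finset (ℤ × ℤ)}
    (hK : LatticeData K T J) (a b c d : ℤ) (h : a * d - b * c = 1) :
    ∃ K', LatticeData K' (T.map (unimodular a b c d h).toEmbedding)
      (J.map (unimodular a b c d h).toEmbedding) := by
  have hR : (a : ℝ) * d - b * c = 1 := by exact_mod_cast h
  let G : (Fin 2 → ℝ) →ₗ[ℝ] (Fin 2 → ℝ) :=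
    { toFun := fun x => ![d * x 0 - b * x 1, a * x 1 - c * x 0]
      map_add' := fun x y => by
        funext i
        fin_cases i <;> simp <;> ring
      map_smul' := fun r x => by
        funext i
        fin_cases i <;> simp <;> ring }
  let F : (Fin 2 → ℝ) ≃ₜ (Fin 2 → ℝ) :=
    { toFun := G
      invFun := fun x => ![a * x 0 + b * x 1, c * x 0 + d * x 1]
      left_inv := fun x => by
        funext i
        fin_cases i
        · simp [G]; linear_combination x 0 * hR
        · simp [G]; linear_combination x 1 * hR
      right_inv := fun x => by
        funext i
        fin_cases i
        · simp [G]; linear_combination x 0 * hR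
        · simp [G]; linear_combination x 1 * hR
      continuous_toFun := G.continuous_of_finiteDimensional
      continuous_invFun := by
        refine continuous_pi fun i => ?_
        fin_cases i <;> simp <;> fun_prop }
  have hF : ∀ z, F (pt z) = pt ((unimodular a b c d h).symm z) := by
    intro z
    funext i
    fin_cases i <;> simp [F, G, pt, unimodular]
  have hint : interior (F ⁻¹' K) = F ⁻¹' interior K := (F.preimage_interior K).symm
  refine ⟨F ⁻¹' K, hK.convex.linear_preimage G, ?_, fun z => ?_, fun z => ?_⟩
  · rw [hint]
    exact hK.interior_nonempty.preimage F.surjective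
  · rw [Finset.mem_map_equiv, hK.mem_T, Set.mem_preimage, hF]
  · rw [Finset.mem_map_equiv, hK.mem_J, hint, Set.mem_preimage, hF]

/-- A point in the relative interior of a horizontal chord of a convex planar set is interior,
provided the set extends strictly above and strictly below the chord. -/
theorem mem_interior_of_between {K : Set (Fin 2 → ℝ)} (hK : Convex ℝ K)
    (hne : (interior K).Nonempty) {u v x y : ℝ} {s t : Fin 2 → ℝ}
    (hu : ![u, y] ∈ K) (hv : ![v, y] ∈ K) (hux : u < x) (hxv : x < v)
    (hs : s ∈ K) (ht : t ∈ K) (hsy : s 1 < y) (hyt : y < t 1) :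
    ![x, y] ∈ interior K := by
  by_contra hx
  obtain ⟨f, hf⟩ := geometric_hahn_banach_open_point hK.interior isOpen_interior hx
  have hle : ∀ z ∈ K, f z ≤ f ![x, y] := by
    intro z hz
    have hz' : z ∈ closure (interior K) := by
      rw [hK.closure_interior_eq_closure_of_nonempty_interior hne]
      exact subset_closure hz
    have hcl : IsClosed {w | f w ≤ f ![x, y]} := isClosed_le f.continuous continuous_const
    exact closure_minimal (fun w hw => (hf w hw).le) hcl hz'
  have hlin : ∀ z : Fin 2 → ℝ, f z = z 0 * f ![1, 0] + z 1 * f ![0, 1] := by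
    intro z
    have : z = z 0 • ![(1 : ℝ), 0] + z 1 • ![(0 : ℝ), 1] := by
      funext i
      fin_cases i <;> simp
    conv_lhs => rw [this]
    simp only [map_add, map_smul, smul_eq_mul]
  have h1 := hle _ hu
  have h2 := hle _ hv
  have h3 := hle _ hs
  have h4 := hle _ ht
  obtain ⟨w, hw⟩ := hne
  have h5 := hf w hw
  rw [hlin, hlin ![x, y]] at h1 h2 h3 h4 h5
  simp only [Matrix.cons_val_zero, Matrix.cons_val_one] at h1 h2 h3 h4 h5
  -- The supporting functional is constant along the chord, hence depends on the height only.
  have hα : f ![1, 0] = 0 := by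
    refine le_antisymm ?_ ?_ <;> by_contra! hc <;> nlinarith
  rw [hα] at h3 h4 h5
  have hβ : f ![0, 1] = 0 := by
    refine le_antisymm ?_ ?_ <;> by_contra! hc <;> nlinarith
  rw [hβ] at h5
  linarith

/-! ### Half-integral counts along lattice segments -/

/-- `⌊t⌋ + ⌈t⌉`: a step function that agrees with `2 * t` at the integers. Like `2 * t`, it is
antisymmetric about every point of `(1/2)ℤ` (`twiceRound_intCast_sub`), which makes its sum along
a lattice segment computable. -/
noncomputable def twiceRound (t : ℝ) : ℤ := ⌊t⌋ + ⌈t⌉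

theorem twiceRound_mono {s t : ℝ} (h : s ≤ t) : twiceRound s ≤ twiceRound t :=
  add_le_add (Int.floor_mono h) (Int.ceil_mono h)

theorem twiceRound_intCast (n : ℤ) : twiceRound n = 2 * n := by
  simp only [twiceRound, Int.floor_intCast, Int.ceil_intCast]
  ring

theorem twiceRound_intCast_sub (n : ℤ) (t : ℝ) :
    twiceRound (n - t) = 2 * n - twiceRound t := by
  simp only [twiceRound, sub_eq_add_neg, Int.floor_intCast_add, Int.ceil_intCast_add,
    Int.floor_neg, Int.ceil_neg]
  ring

/-- The abscissa at height `y` of the line through `(x₀, y₀)` and `(x₁, y₁)`. -/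
noncomputable def lineAt (x₀ y₀ x₁ y₁ y : ℤ) : ℝ :=
  x₀ + (y - y₀) * (x₁ - x₀) / (y₁ - y₀)

theorem lineAt_mem {K : Set (Fin 2 → ℝ)} (hK : Convex ℝ K) {x₀ y₀ x₁ y₁ y : ℤ}
    (h₀ : pt (x₀, y₀) ∈ K) (h₁ : pt (x₁, y₁) ∈ K) (hy₀ : y₀ < y) (hy₁ : y < y₁) :
    ![lineAt x₀ y₀ x₁ y₁ y, (y : ℝ)] ∈ K := by
  have e₀ : (y₀ : ℝ) < y := by exact_mod_cast hy₀
  have e₁ : (y : ℝ) < y₁ := by exact_mod_cast hy₁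
  have hp : (0 : ℝ) < y₁ - y₀ := by linarith
  have hmem := hK h₀ h₁ (a := (y₁ - y) / (y₁ - y₀)) (b := (y - y₀) / (y₁ - y₀))
    (div_nonneg (by linarith) hp.le) (div_nonneg (by linarith) hp.le) (by field_simp; ring)
  convert hmem using 1
  funext i
  fin_cases i
  · simp [pt, lineAt]; field_simp; ring
  · simp [pt]; field_simp; ring

/-- The central symmetry of a lattice segment pairs the heights strictly between its ends. -/
theorem sum_twiceRound_lineAt (x₀ y₀ x₁ y₁ : ℤ) (h : y₀ < y₁) :
    ∑ y ∈ Finset.Ioo y₀ y₁, twiceRound (lineAt x₀ y₀ x₁ y₁ y) =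
      (y₁ - y₀ - 1) * (x₀ + x₁) := by
  have hp : (y₁ : ℝ) - y₀ ≠ 0 := by
    have : (y₀ : ℝ) < y₁ := by exact_mod_cast h
    linarith
  have hrefl : ∑ y ∈ Finset.Ioo y₀ y₁, twiceRound (lineAt x₀ y₀ x₁ y₁ y) =
      ∑ y ∈ Finset.Ioo y₀ y₁, (2 * (x₀ + x₁) - twiceRound (lineAt x₀ y₀ x₁ y₁ y)) := by
    refine Finset.sum_nbij' (fun y => y₀ + y₁ - y) (fun y => y₀ + y₁ - y) ?_ ?_ ?_ ?_ ?_
    · intro y hy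
      simp only [Finset.mem_Ioo] at hy ⊢
      omega
    · intro y hy
      simp only [Finset.mem_Ioo] at hy ⊢
      omega
    · intro y _
      ring
    · intro y _
      ring
    · intro y _
      rw [← twiceRound_intCast_sub]
      congr 1
      simp only [lineAt]
      push_cast
      field_simp
      ring
  rw [Finset.sum_sub_distrib, Finset.sum_const, Int.card_Ioo, nsmul_eq_mul,
    Int.toNat_of_nonneg (by omega)] at hrefl
  linarith

/-- A broken line of lattice segments inside `K` climbing from the bottom point `(a, y₀)` through
`(m, yₘ)` to the top point `(c, y₁)`; the side conditions exclude a horizontal first or last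
segment. -/
theorem exists_chain {K : Set (Fin 2 → ℝ)} (hK : Convex ℝ K) {a m c y₀ yₘ y₁ : ℤ}
    (ha : pt (a, y₀) ∈ K) (hm : pt (m, yₘ) ∈ K) (hc : pt (c, y₁) ∈ K) (h : y₀ < y₁)
    (h₀ : y₀ ≤ yₘ) (h₁ : yₘ ≤ y₁) (h₀' : yₘ = y₀ → a = m) (h₁' : yₘ = y₁ → c = m) :
    ∃ l : ℤ → ℝ, (∀ y ∈ Finset.Ioo y₀ y₁, ![l y, (y : ℝ)] ∈ K) ∧
      ∑ y ∈ Finset.Ioo y₀ y₁, twiceRound (l y) =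
        (yₘ - y₀ - 1) * (a + m) + 2 * m + (y₁ - yₘ - 1) * (m + c) := by
  have hline : ∃ l : ℤ → ℝ, (∀ y ∈ Finset.Ioo y₀ y₁, ![l y, (y : ℝ)] ∈ K) ∧
      ∑ y ∈ Finset.Ioo y₀ y₁, twiceRound (l y) = (y₁ - y₀ - 1) * (a + c) :=
    ⟨lineAt a y₀ c y₁, fun y hy => lineAt_mem hK ha hc (Finset.mem_Ioo.1 hy).1
      (Finset.mem_Ioo.1 hy).2, sum_twiceRound_lineAt a y₀ c y₁ h⟩
  rcases h₀.eq_or_lt with rfl | h₀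
  · obtain rfl := h₀' rfl
    obtain ⟨l, hl, hs⟩ := hline
    exact ⟨l, hl, by rw [hs]; ring⟩
  rcases h₁.eq_or_lt with rfl | h₁
  · obtain rfl := h₁' rfl
    obtain ⟨l, hl, hs⟩ := hline
    exact ⟨l, hl, by rw [hs]; ring⟩
  refine ⟨fun y => if y < yₘ then lineAt a y₀ m yₘ y
    else if y = yₘ then (m : ℝ) else lineAt m yₘ c y₁ y, fun y hy => ?_, ?_⟩
  · rw [Finset.mem_Ioo] at hy
    rcases lt_trichotomy y yₘ with hlt | rfl | hgt
    · simpa only [if_pos hlt] using lineAt_mem hK ha hm hy.1 hlt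
    · simpa only [lt_irrefl, if_false, if_true, pt] using hm
    · simpa only [if_neg hgt.not_gt, if_neg hgt.ne'] using lineAt_mem hK hm hc hgt hy.2
  · have hsplit : Finset.Ioo y₀ y₁ =
        Finset.Ioo y₀ yₘ ∪ insert yₘ (Finset.Ioo yₘ y₁) := by
      ext y
      simp only [Finset.mem_Ioo, Finset.mem_union, Finset.mem_insert]
      omega
    have hdisj : Disjoint (Finset.Ioo y₀ yₘ) (insert yₘ (Finset.Ioo yₘ y₁)) := by
      rw [Finset.disjoint_left]
      intro y
      simp only [Finset.mem_Ioo, Finset.mem_insert]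
      omega
    rw [hsplit, Finset.sum_union hdisj, Finset.sum_insert (by simp)]
    have e₁ : ∀ y ∈ Finset.Ioo y₀ yₘ, twiceRound (if y < yₘ then lineAt a y₀ m yₘ y
        else if y = yₘ then (m : ℝ) else lineAt m yₘ c y₁ y) =
        twiceRound (lineAt a y₀ m yₘ y) := by
      intro y hy
      rw [if_pos (Finset.mem_Ioo.1 hy).2]
    have e₂ : ∀ y ∈ Finset.Ioo yₘ y₁, twiceRound (if y < yₘ then lineAt a y₀ m yₘ y
        else if y = yₘ then (m : ℝ) else lineAt m yₘ c y₁ y) =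
        twiceRound (lineAt m yₘ c y₁ y) := by
      intro y hy
      have := (Finset.mem_Ioo.1 hy).1
      rw [if_neg this.not_gt, if_neg this.ne']
    rw [Finset.sum_congr rfl e₁, Finset.sum_congr rfl e₂, sum_twiceRound_lineAt _ _ _ _ h₀,
      sum_twiceRound_lineAt _ _ _ _ h₁]
    simp only [lt_irrefl, if_false, if_true, twiceRound_intCast]
    ring

/-! ### Counting row by row -/

/-- The lattice points `T` lie in the rows `y₀ ≤ y ≤ y₁`, and the extreme rows consist of the points
with abscissa in the nonempty intervals `[a, b]` (bottom) and `[c, d]` (top). -/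
structure Frame (T : Finset (ℤ × ℤ)) (y₀ y₁ a b c d : ℤ) : Prop where
  lt : y₀ < y₁
  mem_Icc : ∀ z ∈ T, z.2 ∈ Finset.Icc y₀ y₁
  bottom : ∀ x, (x, y₀) ∈ T ↔ a ≤ x ∧ x ≤ b
  top : ∀ x, (x, y₁) ∈ T ↔ c ≤ x ∧ x ≤ d
  bottom_le : a ≤ b
  top_le : c ≤ d

/-- The points of `S` at height `y`. -/
def row (S : Finset (ℤ × ℤ)) (y : ℤ) : Finset (ℤ × ℤ) := {z ∈ S | z.2 = y}

theorem mem_row {S : Finset (ℤ × ℤ)} {y : ℤ} {z : ℤ × ℤ} : z ∈ row S y ↔ z ∈ S ∧ z.2 = y :=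
  Finset.mem_filter

theorem card_row {S : Finset (ℤ × ℤ)} {y a b : ℤ} (h : ∀ x, (x, y) ∈ S ↔ a ≤ x ∧ x ≤ b)
    (hab : a ≤ b) : ((row S y).card : ℤ) = b - a + 1 := by
  have : row S y = (Finset.Icc a b).image fun x => (x, y) := by
    ext ⟨x, w⟩
    rw [mem_row]
    simp only [Finset.mem_image, Finset.mem_Icc, Prod.mk.injEq]
    constructor
    · rintro ⟨hx, rfl⟩
      exact ⟨x, (h x).1 hx, rfl, rfl⟩
    · rintro ⟨x, hx, rfl, rfl⟩
      exact ⟨(h x).2 hx, rfl⟩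
  rw [this, Finset.card_image_of_injective _ (Prod.mk_left_injective y), Int.card_Icc]
  omega

theorem card_eq_sum_row {S : Finset (ℤ × ℤ)} {y₀ y₁ : ℤ} (h : y₀ < y₁)
    (hS : ∀ z ∈ S, z.2 ∈ Finset.Icc y₀ y₁) :
    (S.card : ℤ) = (row S y₀).card + (row S y₁).card +
      ∑ y ∈ Finset.Ioo y₀ y₁, ((row S y).card : ℤ) := by
  have hsplit : Finset.Icc y₀ y₁ = insert y₀ (insert y₁ (Finset.Ioo y₀ y₁)) := by
    ext y
    simp only [Finset.mem_Icc, Finset.mem_insert, Finset.mem_Ioo]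
    omega
  rw [Finset.card_eq_sum_card_fiberwise (f := Prod.snd) (t := Finset.Icc y₀ y₁) hS, hsplit,
    Finset.sum_insert (by simp [h.ne]), Finset.sum_insert (by simp)]
  push_cast
  rw [← add_assoc]
  rfl

variable {K : Set (Fin 2 → ℝ)} {T J : Finset (ℤ × ℤ)} {y₀ y₁ a b c d : ℤ}

theorem LatticeData.subset (hK : LatticeData K T J) : J ⊆ T := fun z hz =>
  (hK.mem_T z).2 (interior_subset ((hK.mem_J z).1 hz))

theorem LatticeData.pt_bottom_left (hK : LatticeData K T J) (hF : Frame T y₀ y₁ a b c d) :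
    pt (a, y₀) ∈ K := (hK.mem_T _).1 ((hF.bottom a).2 ⟨le_rfl, hF.bottom_le⟩)

theorem LatticeData.pt_bottom_right (hK : LatticeData K T J) (hF : Frame T y₀ y₁ a b c d) :
    pt (b, y₀) ∈ K := (hK.mem_T _).1 ((hF.bottom b).2 ⟨hF.bottom_le, le_rfl⟩)

theorem LatticeData.pt_top_left (hK : LatticeData K T J) (hF : Frame T y₀ y₁ a b c d) :
    pt (c, y₁) ∈ K := (hK.mem_T _).1 ((hF.top c).2 ⟨le_rfl, hF.top_le⟩)

theorem LatticeData.pt_top_right (hK : LatticeData K T J) (hF : Frame T y₀ y₁ a b c d) :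
    pt (d, y₁) ∈ K := (hK.mem_T _).1 ((hF.top d).2 ⟨hF.top_le, le_rfl⟩)

theorem LatticeData.mem_J_of_between (hK : LatticeData K T J) (hF : Frame T y₀ y₁ a b c d)
    {x y : ℤ} {u v : ℝ} (hy : y ∈ Finset.Ioo y₀ y₁) (hu : ![u, (y : ℝ)] ∈ K)
    (hv : ![v, (y : ℝ)] ∈ K) (hux : u < x) (hxv : x < v) : (x, y) ∈ J := by
  rw [Finset.mem_Ioo] at hy
  refine (hK.mem_J _).2 (mem_interior_of_between hK.convex hK.interior_nonempty hu hv hux hxv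
    (hK.pt_bottom_left hF) (hK.pt_top_left hF) ?_ ?_)
  · simpa [pt] using hy.1
  · simpa [pt] using hy.2

/-- Each row other than the extreme ones contains at most two non-interior lattice points. -/
theorem LatticeData.card_sub_card_le (hK : LatticeData K T J) (hF : Frame T y₀ y₁ a b c d) :
    (T.card : ℤ) - J.card ≤ (b - a) + (d - c) + 2 * (y₁ - y₀) := by
  have hcard : (T.card : ℤ) - J.card = (T \ J).card := by
    rw [Finset.card_sdiff_of_subset hK.subset, Nat.cast_sub (Finset.card_le_card hK.subset)]
  have hrow : ∀ y, ((row (T \ J) y).card : ℤ) ≤ (row T y).card := fun y => by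
    exact_mod_cast Finset.card_le_card (Finset.filter_subset_filter _ Finset.sdiff_subset)
  have hinner : ∀ y ∈ Finset.Ioo y₀ y₁, ((row (T \ J) y).card : ℤ) ≤ 2 := by
    intro y hy
    rcases (row (T \ J) y).eq_empty_or_nonempty with he | hne
    · simp [he]
    obtain ⟨m, hm, hmin⟩ := Finset.exists_min_image _ Prod.fst hne
    obtain ⟨M, hM, hmax⟩ := Finset.exists_max_image _ Prod.fst hne
    have hsub : row (T \ J) y ⊆ {m, M} := by
      intro z hz
      have h₁ := hmin z hz
      have h₂ := hmax z hz
      obtain ⟨z₁, z₂⟩ := z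
      obtain ⟨m₁, m₂⟩ := m
      obtain ⟨M₁, M₂⟩ := M
      simp only [mem_row, Finset.mem_sdiff] at hm hM hz
      obtain ⟨⟨hmT, -⟩, rfl⟩ := hm
      obtain ⟨⟨hMT, -⟩, rfl⟩ := hM
      obtain ⟨⟨-, hzJ⟩, rfl⟩ := hz
      rw [Finset.mem_insert, Finset.mem_singleton, Prod.mk.injEq, Prod.mk.injEq]
      by_contra hcon
      refine hzJ (hK.mem_J_of_between hF hy ((hK.mem_T _).1 hmT) ((hK.mem_T _).1 hMT) ?_ ?_)
      · have : m₁ < z₁ := by simp only at h₁ h₂; omega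
        exact_mod_cast this
      · have : z₁ < M₁ := by simp only at h₁ h₂; omega
        exact_mod_cast this
    exact_mod_cast (Finset.card_le_card hsub).trans Finset.card_le_two
  have hsum := Finset.sum_le_sum hinner
  rw [Finset.sum_const, Int.card_Ioo, nsmul_eq_mul,
    Int.toNat_of_nonneg (by linarith [hF.lt])] at hsum
  rw [hcard, card_eq_sum_row hF.lt fun z hz => hF.mem_Icc z (Finset.sdiff_subset hz)]
  have h₀ := hrow y₀
  have h₁ := hrow y₁
  rw [card_row hF.bottom hF.bottom_le] at h₀
  rw [card_row hF.top hF.top_le] at h₁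
  linarith

/-- A chord at height `y` bounds the number of lattice points of that row, the interior ones counted
twice, from below. -/
theorem LatticeData.twiceRound_sub_le (hK : LatticeData K T J) (hF : Frame T y₀ y₁ a b c d)
    {y : ℤ} {u v : ℝ} (hy : y ∈ Finset.Ioo y₀ y₁) (hu : ![u, (y : ℝ)] ∈ K)
    (hv : ![v, (y : ℝ)] ∈ K) :
    twiceRound v - twiceRound u ≤ (row T y).card + (row J y).card := by
  rcases le_or_gt v u with hvu | huv
  · have := twiceRound_mono hvu
    omega
  have hT : (Finset.Icc ⌈u⌉ ⌊v⌋).card ≤ (row T y).card := by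
    refine Finset.card_le_card_of_injOn (fun x => (x, y)) (fun x hx => ?_)
      (Prod.mk_left_injective y).injOn
    rw [Finset.coe_Icc, Set.mem_Icc, Int.ceil_le, Int.le_floor] at hx
    refine mem_row.2 ⟨(hK.mem_T _).2 ?_, rfl⟩
    have huv' : v - u ≠ 0 := (sub_pos.2 huv).ne'
    have := hK.convex hu hv (a := (v - x) / (v - u)) (b := (x - u) / (v - u))
      (div_nonneg (by linarith) (by linarith)) (div_nonneg (by linarith) (by linarith))
      (by field_simp; ring)
    convert this using 1
    funext i
    fin_cases i
    · simp [pt]; field_simp; ring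
    · simp [pt]; field_simp; ring
  have hJ : (Finset.Ioo ⌊u⌋ ⌈v⌉).card ≤ (row J y).card := by
    refine Finset.card_le_card_of_injOn (fun x => (x, y)) (fun x hx => ?_)
      (Prod.mk_left_injective y).injOn
    rw [Finset.coe_Ioo, Set.mem_Ioo, Int.floor_lt, Int.lt_ceil] at hx
    exact mem_row.2 ⟨hK.mem_J_of_between hF hy hu hv hx.1 hx.2, rfl⟩
  rw [Int.card_Icc] at hT
  rw [Int.card_Ioo] at hJ
  simp only [twiceRound]
  omega

/-- Two systems of points `l y`, `r y` of `K`, one in each row, bound the lattice points of `K`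
from below, the interior ones counted twice. -/
theorem LatticeData.sum_twiceRound_le (hK : LatticeData K T J) (hF : Frame T y₀ y₁ a b c d)
    {l r : ℤ → ℝ} (hl : ∀ y ∈ Finset.Ioo y₀ y₁, ![l y, (y : ℝ)] ∈ K)
    (hr : ∀ y ∈ Finset.Ioo y₀ y₁, ![r y, (y : ℝ)] ∈ K) :
    ∑ y ∈ Finset.Ioo y₀ y₁, twiceRound (r y) - ∑ y ∈ Finset.Ioo y₀ y₁, twiceRound (l y) +
      (b - a) + (d - c) + 2 ≤ (T.card : ℤ) + J.card := by
  have hsum := Finset.sum_le_sum fun y hy =>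
    hK.twiceRound_sub_le hF hy (hl y hy) (hr y hy)
  rw [Finset.sum_sub_distrib, Finset.sum_add_distrib] at hsum
  rw [card_eq_sum_row hF.lt hF.mem_Icc,
    card_eq_sum_row hF.lt fun z hz => hF.mem_Icc z (hK.subset hz),
    card_row hF.bottom hF.bottom_le, card_row hF.top hF.top_le]
  linarith [Int.natCast_nonneg (row J y₀).card, Int.natCast_nonneg (row J y₁).card]

/-- Comparison with the trapezoid spanned by the extreme rows. -/
theorem LatticeData.trapezoid_le (hK : LatticeData K T J) (hF : Frame T y₀ y₁ a b c d) :
    (y₁ - y₀) * ((b - a) + (d - c)) + 2 ≤ (T.card : ℤ) + J.card := by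
  have h := hK.sum_twiceRound_le hF
    (fun y hy => lineAt_mem hK.convex (hK.pt_bottom_left hF) (hK.pt_top_left hF)
      (Finset.mem_Ioo.1 hy).1 (Finset.mem_Ioo.1 hy).2)
    (fun y hy => lineAt_mem hK.convex (hK.pt_bottom_right hF) (hK.pt_top_right hF)
      (Finset.mem_Ioo.1 hy).1 (Finset.mem_Ioo.1 hy).2)
  rw [sum_twiceRound_lineAt _ _ _ _ hF.lt, sum_twiceRound_lineAt _ _ _ _ hF.lt] at h
  linarith

/-- Comparison with the hexagon spanned by the extreme rows, a leftmost point `L` and a rightmost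
point `R`. -/
theorem LatticeData.hexagon_le (hK : LatticeData K T J) (hF : Frame T y₀ y₁ a b c d)
    {L R : ℤ × ℤ} (hL : L ∈ T) (hR : R ∈ T) (hLmin : ∀ z ∈ T, L.1 ≤ z.1)
    (hRmax : ∀ z ∈ T, z.1 ≤ R.1) :
    (y₁ - y₀) * (R.1 - L.1) + (R.2 - L.2) * (a - c) + (R.2 - y₀) * (b - a) +
      (y₁ - R.2) * (d - c) + 2 ≤ (T.card : ℤ) + J.card := by
  obtain ⟨xL, yL⟩ := L
  obtain ⟨xR, yR⟩ := R
  have hLy := Finset.mem_Icc.1 (hF.mem_Icc _ hL)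
  have hRy := Finset.mem_Icc.1 (hF.mem_Icc _ hR)
  obtain ⟨l, hl, hls⟩ := exists_chain hK.convex (hK.pt_bottom_left hF) ((hK.mem_T _).1 hL)
    (hK.pt_top_left hF) hF.lt hLy.1 hLy.2
    (by
      rintro rfl
      exact le_antisymm ((hF.bottom _).1 hL).1 (hLmin _ ((hK.mem_T _).2 (hK.pt_bottom_left hF))))
    (by
      rintro rfl
      exact le_antisymm ((hF.top _).1 hL).1 (hLmin _ ((hK.mem_T _).2 (hK.pt_top_left hF))))
  obtain ⟨r, hr, hrs⟩ := exists_chain hK.convex (hK.pt_bottom_right hF) ((hK.mem_T _).1 hR)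
    (hK.pt_top_right hF) hF.lt hRy.1 hRy.2
    (by
      rintro rfl
      exact le_antisymm (hRmax _ ((hK.mem_T _).2 (hK.pt_bottom_right hF))) ((hF.bottom _).1 hR).2)
    (by
      rintro rfl
      exact le_antisymm (hRmax _ ((hK.mem_T _).2 (hK.pt_top_right hF))) ((hF.top _).1 hR).2)
  have h := hK.sum_twiceRound_le hF hl hr
  rw [hls, hrs] at h
  refine le_trans (le_of_eq ?_) h
  ring

/-! ### Shearing and the lattice width -/

/-- If, up to the distance `(p - s) / 2`, the extreme rows overlap after vertical projection, where
`p` is the height and `s` the total length of the extreme rows, and if the width is at least the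
height, then the hexagon is large. -/
theorem LatticeData.height_mul_le (hK : LatticeData K T J) (hF : Frame T y₀ y₁ a b c d)
    (hs : (b - a) + (d - c) ≤ y₁ - y₀)
    (hlo : -(2 * (b - a)) - (y₁ - y₀ - ((b - a) + (d - c))) ≤ 2 * (a - c))
    (hhi : 2 * (a - c) ≤ 2 * (d - c) + (y₁ - y₀ - ((b - a) + (d - c))))
    (hw : ∃ z ∈ T, ∃ w ∈ T, y₁ - y₀ ≤ z.1 - w.1) :
    (y₁ - y₀) * ((y₁ - y₀) + ((b - a) + (d - c))) ≤ 2 * ((T.card : ℤ) + J.card - 2) := by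
  obtain ⟨z, hz, w, hwT, hzw⟩ := hw
  obtain ⟨L, hL, hLmin⟩ := T.exists_min_image Prod.fst ⟨z, hz⟩
  obtain ⟨R, hR, hRmax⟩ := T.exists_max_image Prod.fst ⟨z, hz⟩
  have hex := hK.hexagon_le hF hL hR hLmin hRmax
  have hwidth : y₁ - y₀ ≤ R.1 - L.1 := by linarith [hLmin w hwT, hRmax z hz]
  have hLy := Finset.mem_Icc.1 (hF.mem_Icc _ hL)
  have hRy := Finset.mem_Icc.1 (hF.mem_Icc _ hR)
  have hb := hF.bottom_le
  have ht := hF.top_le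
  have h₁ : (y₁ - y₀) * (y₁ - y₀) ≤ (y₁ - y₀) * (R.1 - L.1) :=
    mul_le_mul_of_nonneg_left hwidth (by linarith [hF.lt])
  -- The remaining terms of the hexagon bound are affine in `a - c`, so they are least at one
  -- of the two ends of the admitted range.
  have h₂ : -((y₁ - y₀) * (y₁ - y₀ - ((b - a) + (d - c)))) ≤
      2 * ((R.2 - L.2) * (a - c) + (R.2 - y₀) * (b - a) + (y₁ - R.2) * (d - c)) := by
    rcases le_total L.2 R.2 with h | h
    · linarith [mul_nonneg (sub_nonneg.2 h) (sub_nonneg.2 hlo),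
        mul_nonneg (sub_nonneg.2 hLy.1) (sub_nonneg.2 hb),
        mul_nonneg (sub_nonneg.2 hRy.2) (sub_nonneg.2 ht),
        mul_nonneg (sub_nonneg.2 hLy.1) (sub_nonneg.2 hs),
        mul_nonneg (sub_nonneg.2 hRy.2) (sub_nonneg.2 hs)]
    · linarith [mul_nonneg (sub_nonneg.2 h) (sub_nonneg.2 hhi),
        mul_nonneg (sub_nonneg.2 hRy.1) (sub_nonneg.2 hb),
        mul_nonneg (sub_nonneg.2 hLy.2) (sub_nonneg.2 ht),
        mul_nonneg (sub_nonneg.2 hRy.1) (sub_nonneg.2 hs),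
        mul_nonneg (sub_nonneg.2 hLy.2) (sub_nonneg.2 hs)]
  linarith

theorem Frame.shear (hF : Frame T y₀ y₁ a b c d) (k : ℤ) (h : (1 : ℤ) * 1 - k * 0 = 1) :
    Frame (T.map (unimodular 1 k 0 1 h).toEmbedding) y₀ y₁ (a + k * y₀) (b + k * y₀)
      (c + k * y₁) (d + k * y₁) where
  lt := hF.lt
  mem_Icc z hz := by
    rw [Finset.mem_map_equiv] at hz
    simpa [unimodular] using hF.mem_Icc _ hz
  bottom x := by
    have : (unimodular 1 k 0 1 h).symm (x, y₀) = (x - k * y₀, y₀) := by simp [unimodular]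
    rw [Finset.mem_map_equiv, this, hF.bottom]
    constructor <;> rintro ⟨_, _⟩ <;> constructor <;> linarith
  top x := by
    have : (unimodular 1 k 0 1 h).symm (x, y₁) = (x - k * y₁, y₁) := by simp [unimodular]
    rw [Finset.mem_map_equiv, this, hF.top]
    constructor <;> rintro ⟨_, _⟩ <;> constructor <;> linarith
  bottom_le := by linarith [hF.bottom_le]
  top_le := by linarith [hF.top_le]

/-- A suitable shear brings the extreme rows close to each other. -/
theorem LatticeData.height_mul_le_of_shears (hK : LatticeData K T J)
    (hF : Frame T y₀ y₁ a b c d) (hs : (b - a) + (d - c) ≤ y₁ - y₀)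
    (hw : ∀ k : ℤ, ∃ z ∈ T, ∃ w ∈ T, y₁ - y₀ ≤ (z.1 + k * z.2) - (w.1 + k * w.2)) :
    (y₁ - y₀) * ((y₁ - y₀) + ((b - a) + (d - c))) ≤ 2 * ((T.card : ℤ) + J.card - 2) := by
  have hp : 0 < 2 * (y₁ - y₀) := by linarith [hF.lt]
  -- The shear by `k` lowers `a - c` by `k * (y₁ - y₀)`, and the range allowed for
  -- `2 * (a - c)` has length `2 * (y₁ - y₀)`.
  obtain ⟨k, hk⟩ : ∃ k : ℤ, k = (2 * (a - c) - (-(2 * (b - a)) -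
    (y₁ - y₀ - ((b - a) + (d - c))))) / (2 * (y₁ - y₀)) := ⟨_, rfl⟩
  have hdm := Int.mul_ediv_add_emod (2 * (a - c) - (-(2 * (b - a)) -
    (y₁ - y₀ - ((b - a) + (d - c))))) (2 * (y₁ - y₀))
  have hm₀ := Int.emod_nonneg (2 * (a - c) - (-(2 * (b - a)) -
    (y₁ - y₀ - ((b - a) + (d - c))))) hp.ne'
  have hm₁ := Int.emod_lt_of_pos (2 * (a - c) - (-(2 * (b - a)) -
    (y₁ - y₀ - ((b - a) + (d - c))))) hp
  rw [← hk] at hdm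
  have hdet : (1 : ℤ) * 1 - k * 0 = 1 := by ring
  obtain ⟨K', hK'⟩ := hK.exists_map 1 k 0 1 hdet
  have h := hK'.height_mul_le (hF.shear k hdet) (by linarith) (by linarith) (by linarith) (by
    obtain ⟨z, hz, w, hwT, hzw⟩ := hw k
    refine ⟨_, Finset.mem_map_of_mem _ hz, _, Finset.mem_map_of_mem _ hwT, ?_⟩
    simpa [unimodular] using hzw)
  rw [Finset.card_map, Finset.card_map] at h
  linarith

/-- Scott's inequality in coordinates whose second axis realises the lattice width. -/
theorem LatticeData.scott_of_frame (hK : LatticeData K T J) (hF : Frame T y₀ y₁ a b c d)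
    (hp : 2 ≤ y₁ - y₀)
    (hw : ∀ k : ℤ, ∃ z ∈ T, ∃ w ∈ T, y₁ - y₀ ≤ (z.1 + k * z.2) - (w.1 + k * w.2)) :
    (J.card = 1 ∧ T.card = 10) ∨ T.card ≤ 3 * J.card + 6 := by
  have hA := hK.card_sub_card_le hF
  have hB := hK.trapezoid_le hF
  have hC := hK.height_mul_le_of_shears hF
  have hb := hF.bottom_le
  have ht := hF.top_le
  obtain ⟨p, hpe⟩ : ∃ p, p = y₁ - y₀ := ⟨_, rfl⟩
  obtain ⟨s, hse⟩ : ∃ s, s = (b - a) + (d - c) := ⟨_, rfl⟩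
  rw [← hpe] at hA hB hC hp hw
  rw [← hse] at hA hB hC
  have hs0 : 0 ≤ s := by linarith
  -- If `4 ≤ s` or `p = 2`, the trapezoid suffices; otherwise `s ≤ 3 ≤ p`, so the shear applies.
  rcases le_or_gt 4 s with h4 | h4
  · have := mul_nonneg (sub_nonneg.2 h4) (sub_nonneg.2 hp)
    right
    zify
    linarith
  have hp' : p = 2 ∨ p = 3 ∨ 4 ≤ p := by omega
  rcases hp' with rfl | rfl | hp4
  · right
    omega
  · have hC' := hC (by linarith) hw
    omega
  · have hC' := hC (by linarith) hw
    have := mul_nonneg (sub_nonneg.2 hp4) (show 0 ≤ p - 4 + s by linarith)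
    right
    zify
    linarith

theorem LatticeData.exists_row_eq (hK : LatticeData K T J) {y : ℤ} (h : ∃ z ∈ T, z.2 = y) :
    ∃ a b : ℤ, a ≤ b ∧ ∀ x, (x, y) ∈ T ↔ a ≤ x ∧ x ≤ b := by
  obtain ⟨z, hz, rfl⟩ := h
  have hne : (row T z.2).Nonempty := ⟨z, mem_row.2 ⟨hz, rfl⟩⟩
  obtain ⟨⟨a, y⟩, ha, hmin⟩ := Finset.exists_min_image _ Prod.fst hne
  obtain ⟨⟨b, y'⟩, hb, hmax⟩ := Finset.exists_max_image _ Prod.fst hne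
  obtain ⟨haT, hay⟩ := mem_row.1 ha
  obtain ⟨hbT, hby⟩ := mem_row.1 hb
  simp only at hay hby
  subst hay hby
  refine ⟨a, b, hmin _ hb, fun x => ⟨fun hx => ?_, fun hx => ?_⟩⟩
  · exact ⟨hmin _ (mem_row.2 ⟨hx, rfl⟩), hmax _ (mem_row.2 ⟨hx, rfl⟩)⟩
  · rcases hx.1.eq_or_lt with rfl | hax
    · exact haT
    have h₁ : (a : ℝ) < x := by exact_mod_cast hax
    have h₂ : (x : ℝ) ≤ b := by exact_mod_cast hx.2
    have h₃ : (b : ℝ) - a ≠ 0 := by linarith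
    have := hK.convex ((hK.mem_T _).1 haT) ((hK.mem_T _).1 hbT) (a := (b - x) / (b - a))
      (b := (x - a) / (b - a)) (div_nonneg (by linarith) (by linarith))
      (div_nonneg (by linarith) (by linarith)) (by field_simp; ring)
    rw [hK.mem_T]
    convert this using 1
    funext i
    fin_cases i
    · simp [pt]; field_simp; ring
    · simp [pt]; field_simp; ring

/-- Scott's inequality for convex sets whose lattice width is at least two. A direction realising
the lattice width is completed to a basis of the lattice. -/
theorem LatticeData.scott (hK : LatticeData K T J)
    (hwide : ∀ A B : ℤ, IsCoprime A B →
      ∃ z ∈ T, ∃ w ∈ T, 2 ≤ (A * z.1 + B * z.2) - (A * w.1 + B * w.2)) :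
    (J.card = 1 ∧ T.card = 10) ∨ T.card ≤ 3 * J.card + 6 := by
  classical
  have hex : ∃ n : ℕ, ∃ A B : ℤ, IsCoprime A B ∧
      ∀ z ∈ T, ∀ w ∈ T, (A * z.1 + B * z.2) - (A * w.1 + B * w.2) ≤ n := by
    obtain ⟨z, hz, -⟩ := hwide 1 0 isCoprime_one_left
    obtain ⟨M, hM, hmax⟩ := T.exists_max_image Prod.fst ⟨z, hz⟩
    obtain ⟨m, hm, hmin⟩ := T.exists_min_image Prod.fst ⟨z, hz⟩
    refine ⟨(M.1 - m.1).toNat, 1, 0, isCoprime_one_left, fun z hz w hw => ?_⟩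
    have h₁ := hmax z hz
    have h₂ := hmin w hw
    omega
  obtain ⟨A, B, hAB, hle⟩ := Nat.find_spec hex
  have hmin := fun m => @Nat.find_min _ _ hex m
  obtain ⟨n, hn⟩ : ∃ n, n = Nat.find hex := ⟨_, rfl⟩
  rw [← hn] at hle hmin
  have hn2 : 2 ≤ n := by
    obtain ⟨z, hz, w, hw, h⟩ := hwide A B hAB
    have := hle z hz w hw
    omega
  have hge : ∀ A B : ℤ, IsCoprime A B →
      ∃ z ∈ T, ∃ w ∈ T, (n : ℤ) ≤ (A * z.1 + B * z.2) - (A * w.1 + B * w.2) := by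
    intro A B hAB
    by_contra! hcon
    refine hmin (n - 1) (by omega) ⟨A, B, hAB, fun z hz w hw => ?_⟩
    have := hcon z hz w hw
    omega
  obtain ⟨u, v, huv⟩ := hAB
  have hdet : v * B - (-u) * A = 1 := by linarith
  obtain ⟨K', hK'⟩ := hK.exists_map v (-u) A B hdet
  obtain ⟨z, hz, w, hw, hzw⟩ := hge A B ⟨u, v, huv⟩
  have hmem : ∀ z ∈ T, unimodular v (-u) A B hdet z ∈
      T.map (unimodular v (-u) A B hdet).toEmbedding := fun z hz => Finset.mem_map_of_mem _ hz
  obtain ⟨a, b, hab, hbot⟩ := hK'.exists_row_eq (y := A * w.1 + B * w.2) ⟨_, hmem w hw, rfl⟩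
  obtain ⟨c, d, hcd, htop⟩ := hK'.exists_row_eq (y := A * z.1 + B * z.2) ⟨_, hmem z hz, rfl⟩
  have hzw' := hle z hz w hw
  have hF : Frame (T.map (unimodular v (-u) A B hdet).toEmbedding)
      (A * w.1 + B * w.2) (A * z.1 + B * z.2) a b c d :=
    { lt := by omega
      mem_Icc := by
        intro x hx
        obtain ⟨x, hxT, rfl⟩ := Finset.mem_map.1 hx
        have h₁ := hle x hxT w hw
        have h₂ := hle z hz x hxT
        have h₃ : ((unimodular v (-u) A B hdet).toEmbedding x).2 = A * x.1 + B * x.2 := rfl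
        rw [h₃, Finset.mem_Icc]
        constructor <;> linarith
      bottom := hbot
      top := htop
      bottom_le := hab
      top_le := hcd }
  have h := hK'.scott_of_frame hF (by omega) (by
    intro k
    have hcop : IsCoprime (v + k * A) (-u + k * B) := ⟨B, -A, by linarith⟩
    obtain ⟨x, hx, y, hy, hxy⟩ := hge _ _ hcop
    refine ⟨_, hmem x hx, _, hmem y hy, ?_⟩
    simp only [unimodular, Equiv.coe_fn_mk]
    linarith)
  rwa [Finset.card_map, Finset.card_map] at h

/-! ### Lattice points around an interior point of the integral hull -/

/-- A nonzero integral linear form takes a larger value at some lattice point of `P` than at a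
given interior point of the integral hull. -/
theorem exists_lt_of_mem_interior_integralHull {P : Set (Fin 2 → ℝ)} {x : Fin 2 → ℝ}
    (hx : x ∈ interior (integralHull P)) {A B : ℤ} (hAB : A ≠ 0 ∨ B ≠ 0) :
    ∃ z : ℤ × ℤ, pt z ∈ P ∧ A * x 0 + B * x 1 < A * z.1 + B * z.2 := by
  by_contra! hcon
  have hsub : integralHull P ⊆ {y | (A : ℝ) * y 0 + B * y 1 ≤ A * x 0 + B * x 1} := by
    refine convexHull_min ?_ ?_
    · rintro y ⟨hyP, hyl⟩
      rw [← range_pt] at hyl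
      obtain ⟨z, rfl⟩ := hyl
      exact hcon z hyP
    · exact convex_halfSpace_le
        (f := fun y : Fin 2 → ℝ => (A : ℝ) * y 0 + B * y 1)
        ⟨fun y z => by simp only [Pi.add_apply]; ring,
          fun r y => by simp only [Pi.smul_apply, smul_eq_mul]; ring⟩ _
  -- Moving from `x` along the gradient of the form leaves the half-plane at once.
  have hcont : Filter.Tendsto (fun t : ℝ => x + t • ![(A : ℝ), (B : ℝ)])
      (nhdsWithin 0 (Set.Ioi 0)) (nhds x) := by
    have : Continuous fun t : ℝ => x + t • ![(A : ℝ), (B : ℝ)] := by fun_prop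
    have h := (this.tendsto 0).mono_left (nhdsWithin_le_nhds (s := Set.Ioi 0))
    simpa using h
  have hev := hcont.eventually (mem_interior_iff_mem_nhds.1 hx)
  obtain ⟨t, ht, ht0⟩ := (hev.and self_mem_nhdsWithin).exists
  have h : (A : ℝ) * (x 0 + t * A) + B * (x 1 + t * B) ≤ A * x 0 + B * x 1 := hsub ht
  have hpos : 0 < (A : ℝ) ^ 2 + (B : ℝ) ^ 2 := by
    rcases hAB with h | h
    · have : (A : ℝ) ≠ 0 := by exact_mod_cast h
      positivity
    · have : (B : ℝ) ≠ 0 := by exact_mod_cast h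
      positivity
  have ht0 : 0 < t := ht0
  nlinarith [mul_pos ht0 hpos]

end RationalPolygon

theorem mainTheorem3 (P : Set (Fin 2 → ℝ)) (hP : RationalPolygon.IsRationalPolygon P)
    (hint : (interior (RationalPolygon.integralHull P) ∩ RationalPolygon.lattice).Nonempty) :
    (RationalPolygon.interiorCount P = 1 ∧ RationalPolygon.boundaryCount P = 9) ∨
      RationalPolygon.boundaryCount P ≤ 2 * RationalPolygon.interiorCount P + 6 := by
  open RationalPolygon in
  obtain ⟨V, hV, -, -, rfl⟩ := hP
  obtain ⟨x, hx, hxl⟩ := hint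
  have hclosed : IsClosed (convexHull ℝ V) := hV.isClosed_convexHull ℝ
  have hconv : Convex ℝ (convexHull ℝ V) := convex_convexHull ℝ V
  have hfin : (pt ⁻¹' convexHull ℝ V).Finite := by
    have h := finite_inter_lattice (isBounded_convexHull.2 hV.isBounded : Bornology.IsBounded
      (convexHull ℝ V))
    exact Set.Finite.of_finite_image ((h.subset (by
      rw [← range_pt, ← Set.image_preimage_eq_inter_range]))) pt_injective.injOn
  have hfinJ : (pt ⁻¹' interior (convexHull ℝ V)).Finite :=
    hfin.subset (Set.preimage_mono interior_subset)
  have hhull : integralHull (convexHull ℝ V) ⊆ convexHull ℝ V :=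
    convexHull_min Set.inter_subset_left hconv
  have hK : LatticeData (convexHull ℝ V) hfin.toFinset hfinJ.toFinset :=
    { convex := hconv
      interior_nonempty := ⟨x, interior_mono hhull hx⟩
      mem_T := fun z => hfin.mem_toFinset
      mem_J := fun z => hfinJ.mem_toFinset }
  have hscott := hK.scott (by
    intro A B hAB
    have hne : A ≠ 0 ∨ B ≠ 0 := by
      by_contra! h
      obtain ⟨rfl, rfl⟩ := h
      obtain ⟨u, v, huv⟩ := hAB
      simp at huv
    rw [← range_pt] at hxl
    obtain ⟨w, rfl⟩ := hxl
    obtain ⟨z, hz, h₁⟩ := exists_lt_of_mem_interior_integralHull hx hne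
    obtain ⟨z', hz', h₂⟩ := exists_lt_of_mem_interior_integralHull hx
      (A := -A) (B := -B) (by simpa using hne)
    refine ⟨z, hfin.mem_toFinset.2 hz, z', hfin.mem_toFinset.2 hz', ?_⟩
    simp only [pt, Matrix.cons_val_zero, Matrix.cons_val_one] at h₁ h₂
    norm_cast at h₁ h₂
    linarith)
  have hI : interiorCount (convexHull ℝ V) = hfinJ.toFinset.card := by
    rw [interiorCount, ncard_inter_lattice, Set.ncard_eq_toFinset_card _ hfinJ]
  have hb : boundaryCount (convexHull ℝ V) + interiorCount (convexHull ℝ V) =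
      hfin.toFinset.card := by
    rw [← Set.ncard_eq_toFinset_card _ hfin, boundaryCount, interiorCount, ncard_inter_lattice,
      ncard_inter_lattice, hclosed.frontier_eq, Set.preimage_sdiff,
      Set.ncard_sdiff_add_ncard_of_subset (Set.preimage_mono interior_subset) hfin]
  omega
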